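/- Let $G$ be a (discrete) group. Let $\mathcal G$ be the groupoid of the adjoint action of $G$: its objects are the elements of $G$, $\mathrm{Mor}(a,b)=\{x\in G: xax^{-1}=b\}$, and the composite of $x:a\to b$ and $y:b\to c$ is $yx$. For a conjugacy class $c$ of $G$ let $\mathcal G_{c}$ be the full subgroupoid of $\mathcal G$ on the elements of $c$. Let $r\mathcal G$ be the groupoid of the right action of $G$ on itself: its objects are the elements of $G$, $\mathrm{Mor}(a,b)=\{x\in G: ax=b\}$, and the composite of $x:a\to b$ and $y:b\to c$ is $xy$. The group $G$ acts on $r\mathcal G$, and hence on its classifying space, by left translations ($h$ sends the object $a$ to $ha$ and the morphism $x:a\to b$ to $x:ha\to hb$). The classifying space $B\mathcal C$ of a category $\mathcal C$ is the geometric realization of its nerve. For $g\in G$ let $\langle g\rangle$ be its conjugacy class and $C(g)=\{h\in G: hg=gh\}$ its centralizer. Then: 1. The inclusions $\mathcal G_{c}\hookrightarrow\mathcal G$ induce a homeomorphism $$\coprod_{c}B\mathcal G_{c}\;\xrightarrow{\ \approx\ }\;B\mathcal G ,$$ where $c$ runs over the conjugacy classes of $G$. 2. For every $g\in G$ the space $B\mathcal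 G_{\langle g\rangle}$ is homeomorphic to the orbit space $(Br\mathcal G)/C(g)$ of the action of $C(g)\subseteq G$ on $Br\mathcal G$ by left translations. 3. For every $g\in G$ the space $B\mathcal G_{\langle g\rangle}$ is an Eilenberg–MacLane space $K(C(g),1)$: it is path connected, its fundamental group at every base point is isomorphic to $C(g)$, and $\pi_n(B\mathcal G_{\langle g\rangle},x)$ is trivial for all $n\ge 2$ and all base points $x$. Moreover it is homotopy equivalent to the classifying space $BC(g)$ of the group $C(g)$, regarded as a category with one object. -/

import Mathlib

open CategoryTheory

universe u v w

/-- The classifying space `BC` of a category: the geometric realization of its nerve, whose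
`k`-simplices are the strings of `k` composable morphisms. -/
noncomputable abbrev ClassifyingSpace (C : Type u) [Category.{v} C] : TopCat.{max u v} :=
  SSet.toTop.obj (nerve C)

/-- The continuous map of classifying spaces induced by a functor. -/
noncomputable def classifyingSpaceMap {C D : Type u} [Category.{v} C] [Category.{v} D]
    (F : C ⥤ D) : ClassifyingSpace C ⟶ ClassifyingSpace D :=
  SSet.toTop.map (nerveMap F)

/-- The objects of the groupoid of the adjoint action of `G` on itself: the elements of `G`. -/
@[ext]
structure AdjointGroupoid (G : Type u) where
  /-- the underlying element of the group -/
  elt : G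

namespace AdjointGroupoid

variable {G : Type u} [Group G]

/-- A morphism `a ⟶ b` is an `x` with `x * a * x⁻¹ = b`; the composite of `x : a ⟶ b` and
`y : b ⟶ c` is `y * x`. -/
instance : Groupoid.{u} (AdjointGroupoid G) where
  Hom a b := {x : G // x * a.elt * x⁻¹ = b.elt}
  id a := ⟨1, by simp⟩
  comp x y := ⟨y.1 * x.1, by
    obtain ⟨x, hx⟩ := x
    obtain ⟨y, hy⟩ := y
    simp [← hy, ← hx, mul_assoc]⟩
  inv x := ⟨x.1⁻¹, by simp [← show _ = _ from x.2, mul_assoc]⟩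
  id_comp x := Subtype.ext (mul_one x.1)
  comp_id x := Subtype.ext (one_mul x.1)
  assoc x y z := Subtype.ext (mul_assoc z.1 y.1 x.1).symm
  inv_comp x := Subtype.ext (mul_inv_cancel x.1)
  comp_inv x := Subtype.ext (inv_mul_cancel x.1)

/-- The property of an object of being an element of the conjugacy class `c`. -/
def inClass (c : ConjClasses G) : ObjectProperty (AdjointGroupoid G) :=
  fun a => ConjClasses.mk a.elt = c

/-- The full subgroupoid on the elements of the conjugacy class `c`. -/
abbrev Component (c : ConjClasses G) : Type u := (inClass c).FullSubcategory

/-- The map from the disjoint union of the classifying spaces of the subgroupoids of the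
conjugacy classes to the classifying space of the whole groupoid, induced by the inclusions. -/
noncomputable def fromCoproduct (G : Type u) [Group G] :
    (Σ c : ConjClasses G, ClassifyingSpace (Component c)) →
      ClassifyingSpace (AdjointGroupoid G) :=
  fun p => classifyingSpaceMap (inClass p.1).ι p.2

end AdjointGroupoid

/-- The objects of the groupoid of the right action of `G` on itself: the elements of `G`. -/
@[ext]
structure RightGroupoid (G : Type u) where
  /-- the underlying element of the group -/
  elt : G

namespace RightGroupoid

variable {G : Type u} [Group G]

/-- A morphism `a ⟶ b` is an `x` with `a * x = b`; the composite of `x : a ⟶ b` and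
`y : b ⟶ c` is `x * y`. -/
instance : Groupoid.{u} (RightGroupoid G) where
  Hom a b := {x : G // a.elt * x = b.elt}
  id a := ⟨1, mul_one _⟩
  comp x y := ⟨x.1 * y.1, by rw [← mul_assoc, x.2, y.2]⟩
  inv x := ⟨x.1⁻¹, mul_inv_eq_of_eq_mul x.2.symm⟩
  id_comp x := Subtype.ext (one_mul x.1)
  comp_id x := Subtype.ext (mul_one x.1)
  assoc x y z := Subtype.ext (mul_assoc x.1 y.1 z.1)
  inv_comp x := Subtype.ext (inv_mul_cancel x.1)
  comp_inv x := Subtype.ext (mul_inv_cancel x.1)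

instance (a b : RightGroupoid G) : Subsingleton (a ⟶ b) :=
  ⟨fun x y => Subtype.ext (mul_left_cancel (x.2.trans y.2.symm))⟩

/-- Left translation by `h`: it sends the object `a` to `h * a` and the morphism given by `x`
to the morphism given by `x`. -/
def leftTranslation (h : G) : RightGroupoid G ⥤ RightGroupoid G where
  obj a := ⟨h * a.elt⟩
  map x := ⟨x.1, by rw [mul_assoc, x.2]⟩

theorem leftTranslation_one : leftTranslation (1 : G) = 𝟭 (RightGroupoid G) :=
  CategoryTheory.Functor.ext (fun a => RightGroupoid.ext (one_mul a.elt))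
    fun _ _ _ => Subsingleton.elim _ _

theorem leftTranslation_mul (h k : G) :
    leftTranslation (h * k) = leftTranslation k ⋙ leftTranslation h :=
  CategoryTheory.Functor.ext (fun a => RightGroupoid.ext (mul_assoc h k a.elt))
    fun _ _ _ => Subsingleton.elim _ _

/-- The action of `G` on the classifying space of its right action groupoid that is induced by
the left translations. -/
noncomputable instance : MulAction G (ClassifyingSpace (RightGroupoid G)) where
  smul h p := classifyingSpaceMap (leftTranslation h) p
  one_smul p := by
    change classifyingSpaceMap (leftTranslation 1) p = p
    rw [leftTranslation_one]
    change SSet.toTop.map (𝟙 (nerve (RightGroupoid G))) p = p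
    simp
  mul_smul h k p := by
    change classifyingSpaceMap (leftTranslation (h * k)) p =
      classifyingSpaceMap (leftTranslation h) (classifyingSpaceMap (leftTranslation k) p)
    rw [leftTranslation_mul]
    change SSet.toTop.map (nerveMap (leftTranslation k) ≫ nerveMap (leftTranslation h)) p = _
    rw [Functor.map_comp]
    rfl

end RightGroupoid

/-- `X` is an Eilenberg–MacLane space `K(A, 1)`: it is path connected, its fundamental group is
isomorphic to `A`, and its higher homotopy groups vanish. -/
structure IsEilenbergMacLaneOne (A : Type u) [Group A] (X : Type w) [TopologicalSpace X] :
    Prop where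
  pathConnectedSpace : PathConnectedSpace X
  fundamentalGroup : ∀ x : X, Nonempty (FundamentalGroup X x ≃* A)
  higher : ∀ n : ℕ, 2 ≤ n → ∀ x : X, Subsingleton (HomotopyGroup.Pi n X x)

/-!
A continuous map out of a geometric realization is a compatible family of maps on the simplices.
Hence a homeomorphism onto a realization can be checked on simplices: every chain in `𝒢` stays in
one conjugacy class, and every chain in `𝒢_⟨g⟩` is the image, under `a ↦ a⁻¹ * g * a`, of a chain
in `r𝒢` that is unique up to left translation by `C(g)`.

A point of `Br𝒢` lying in a simplex with vertices `a₀, …, aₙ` gives a step function on `[0, 1)` with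
the values `a₀, …, aₙ`, in this order, on intervals whose lengths are the barycentric coordinates.
Here the order of the vertices matters: an unordered distribution of weights on `G` can be fixed by
a nontrivial element of finite order. Left translation by `h ≠ 1` changes a step function
everywhere, so the action on `Br𝒢` is free and properly discontinuous, and `Br𝒢 → B𝒢_⟨g⟩` is a
covering with group `C(g)`.

In a groupoid all objects of a chain are related by isomorphisms in both directions, so a natural
transformation of functors between groupoids gives a homotopy, moving each simplex along segments in
a simplex with twice as many vertices. Therefore `Br𝒢` is contractible, which makes `B𝒢_⟨g⟩` a
`K(C(g), 1)`, and the equivalence of `𝒢_⟨g⟩` with `C(g)` gives a homotopy equivalence.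
-/

open Opposite

section Realization

variable {X Y : SSet.{u}}

/-- The characteristic map of a simplex: the canonical map from the topological simplex to the
geometric realization. -/
noncomputable def characteristicMap {n : SimplexCategory} (x : X.obj (op n)) :
    C(stdSimplex ℝ (Fin (n.len + 1)), SSet.toTop.obj X) :=
  TopCat.toSSetObjEquiv _ (op n) ((sSetTopAdj.unit.app X).app (op n) x)

theorem characteristicMap_map {n m : SimplexCategory} (f : n ⟶ m) (x : X.obj (op m))
    (t : stdSimplex ℝ (Fin (n.len + 1))) :
    characteristicMap (X.map f.op x) t = characteristicMap x (stdSimplex.map f t) := by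
  have h := ConcreteCategory.congr_hom ((sSetTopAdj.unit.app X).naturality f.op) x
  exact congrArg (fun z => TopCat.toSSetObjEquiv _ (op n) z t) h

theorem toTop_map_characteristicMap (φ : X ⟶ Y) {n : SimplexCategory} (x : X.obj (op n))
    (t : stdSimplex ℝ (Fin (n.len + 1))) :
    SSet.toTop.map φ (characteristicMap x t) = characteristicMap (φ.app (op n) x) t := by
  have h := ConcreteCategory.congr_hom
    (NatTrans.congr_app (sSetTopAdj.unit.naturality φ) (op n)) x
  exact (congrArg (fun z => TopCat.toSSetObjEquiv _ (op n) z t) h).symm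

/-- A cocone under the diagram of topological simplices whose colimit is the geometric realization
of `X`: a compatible family of continuous maps, one for each simplex. -/
structure RealizationCocone (X : SSet.{u}) (Z : Type u) [TopologicalSpace Z] where
  /-- the map on the topological simplex that belongs to a simplex -/
  toFun : ∀ {n : SimplexCategory}, X.obj (op n) → C(stdSimplex ℝ (Fin (n.len + 1)), Z)
  map : ∀ {n m : SimplexCategory} (f : n ⟶ m) (x : X.obj (op m))
    (t : stdSimplex ℝ (Fin (n.len + 1))),
    toFun (X.map f.op x) t = toFun x (stdSimplex.map f t)

theorem realization_ext {Z : Type u} [TopologicalSpace Z] {f g : C(SSet.toTop.obj X, Z)}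
    (h : ∀ {n : SimplexCategory} (x : X.obj (op n)) (t : stdSimplex ℝ (Fin (n.len + 1))),
      f (characteristicMap x t) = g (characteristicMap x t)) : f = g := by
  have : TopCat.ofHom f = TopCat.ofHom g := by
    apply (sSetTopAdj.homEquiv X (TopCat.of Z)).injective
    ext n x
    rw [Adjunction.homEquiv_unit, Adjunction.homEquiv_unit]
    apply (TopCat.toSSetObjEquiv (TopCat.of Z) n).injective
    ext t
    exact h (n := n.unop) x t
  exact congrArg TopCat.Hom.hom this

theorem exists_characteristicMap_eq (p : SSet.toTop.obj X) :
    ∃ (n : SimplexCategory) (x : X.obj (op n)) (t : stdSimplex ℝ (Fin (n.len + 1))),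
      characteristicMap x t = p := by
  -- The indicator of the union of the simplices is continuous for the indiscrete topology.
  let : TopologicalSpace (ULift.{u} Prop) := ⊤
  have h := realization_ext (X := X) (Z := ULift.{u} Prop)
    (f := ⟨fun q => ⟨∃ (n : SimplexCategory) (x : X.obj (op n))
      (t : stdSimplex ℝ (Fin (n.len + 1))), characteristicMap x t = q⟩, continuous_top⟩)
    (g := ⟨fun _ => ⟨True⟩, continuous_top⟩)
    (fun x t => congrArg ULift.up (eq_true ⟨_, x, t, rfl⟩))
  exact of_eq_true (congrArg ULift.down (DFunLike.congr_fun h p))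

namespace RealizationCocone

variable {Z : Type u} [TopologicalSpace Z] (c : RealizationCocone X Z)

/-- The map to the singular simplicial set that is adjoint to a cocone. -/
noncomputable def toSSet : X ⟶ TopCat.toSSet.obj (TopCat.of Z) where
  app n := ↾fun x => (TopCat.toSSetObjEquiv (TopCat.of Z) n).symm (c.toFun (n := n.unop) x)
  naturality n m f := by
    ext x
    apply (TopCat.toSSetObjEquiv (TopCat.of Z) m).injective
    ext t
    exact c.map f.unop x t

/-- The continuous map on the geometric realization that is induced by a cocone. -/
noncomputable def desc : C(SSet.toTop.obj X, Z) :=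
  ((sSetTopAdj.homEquiv X (TopCat.of Z)).symm c.toSSet).hom

theorem desc_characteristicMap {n : SimplexCategory} (x : X.obj (op n))
    (t : stdSimplex ℝ (Fin (n.len + 1))) : c.desc (characteristicMap x t) = c.toFun x t := by
  have h := (sSetTopAdj.homEquiv X (TopCat.of Z)).apply_symm_apply c.toSSet
  rw [Adjunction.homEquiv_unit] at h
  have h' := ConcreteCategory.congr_hom (NatTrans.congr_app h (op n)) x
  exact congrArg (fun z => TopCat.toSSetObjEquiv _ (op n) z t) h'

/-- A space `Z` is the geometric realization if it is covered by a cocone of simplices that are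
carried to the characteristic maps by a continuous map. -/
noncomputable def homeomorph (f : C(Z, SSet.toTop.obj X))
    (hf : ∀ {n : SimplexCategory} (x : X.obj (op n)) (t : stdSimplex ℝ (Fin (n.len + 1))),
      f (c.toFun x t) = characteristicMap x t)
    (hc : ∀ z, ∃ (n : SimplexCategory) (x : X.obj (op n)) (t : stdSimplex ℝ (Fin (n.len + 1))),
      c.toFun x t = z) : Z ≃ₜ SSet.toTop.obj X where
  toFun := f
  invFun := c.desc
  left_inv z := by
    obtain ⟨n, x, t, rfl⟩ := hc z
    rw [hf, desc_characteristicMap]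
  right_inv p := by
    obtain ⟨n, x, t, rfl⟩ := exists_characteristicMap_eq p
    rw [desc_characteristicMap, hf]
  continuous_toFun := map_continuous f
  continuous_invFun := map_continuous _

end RealizationCocone

theorem isHomeomorph_sigma_toTop_map {ι : Type u} {X : ι → SSet.{u}} {Y : SSet.{u}}
    (φ : ∀ i, X i ⟶ Y)
    (h : ∀ n, Function.Bijective fun p : Σ i, (X i).obj n => (φ p.1).app n p.2) :
    IsHomeomorph fun p : Σ i, SSet.toTop.obj (X i) => SSet.toTop.map (φ p.1) p.2 := by
  let e {n} : (Σ i, (X i).obj n) ≃ Y.obj n := Equiv.ofBijective _ (h n)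
  let point {n : SimplexCategory} (p : Σ i, (X i).obj (op n))
      (t : stdSimplex ℝ (Fin (n.len + 1))) : Σ i, SSet.toTop.obj (X i) :=
    ⟨p.1, characteristicMap p.2 t⟩
  let c : RealizationCocone Y (Σ i, SSet.toTop.obj (X i)) :=
    { toFun y := ⟨point (e.symm y), continuous_sigmaMk.comp (map_continuous _)⟩
      map f y t := by
        obtain ⟨⟨i, x⟩, rfl⟩ := e.surjective y
        have hx : e.symm (Y.map f.op (e ⟨i, x⟩)) = ⟨i, (X i).map f.op x⟩ :=
          e.symm_apply_eq.2 (ConcreteCategory.congr_hom ((φ i).naturality f.op) x).symm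
        simp only [ContinuousMap.coe_mk, hx, e.symm_apply_apply]
        exact congrArg (Sigma.mk i) (characteristicMap_map f x t) }
  refine (c.homeomorph ⟨fun p => SSet.toTop.map (φ p.1) p.2,
    continuous_sigma fun i => (SSet.toTop.map (φ i)).hom.continuous⟩ (fun y t => ?_)
    fun ⟨i, p⟩ => ?_).isHomeomorph
  · exact (toTop_map_characteristicMap _ _ t).trans
      (congrArg (characteristicMap · t) (e.apply_symm_apply y))
  · obtain ⟨n, x, t, rfl⟩ := exists_characteristicMap_eq p
    exact ⟨n, e ⟨i, x⟩, t, congrArg (point · t) (e.symm_apply_apply _)⟩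

/-- If `φ` is surjective on simplices, and `s` identifies two points exactly if they are
corresponding points of simplices with the same image, then the geometric realization of `Y` is the
quotient of that of `X` by `s`. -/
noncomputable def quotientRealizationHomeomorph (φ : X ⟶ Y) (s : Setoid (SSet.toTop.obj X))
    (hφ : ∀ n, Function.Surjective (φ.app n))
    (hs : ∀ p q, s p q → SSet.toTop.map φ p = SSet.toTop.map φ q)
    (hs' : ∀ {n : SimplexCategory} {x y : X.obj (op n)}, φ.app _ x = φ.app _ y →
      ∀ t, s (characteristicMap x t) (characteristicMap y t)) :
    Quotient s ≃ₜ SSet.toTop.obj Y :=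
  let c : RealizationCocone Y (Quotient s) :=
    { toFun {n} y := ⟨fun t => Quotient.mk s (characteristicMap (hφ (op n) y).choose t),
        continuous_quotient_mk'.comp (map_continuous _)⟩
      map {n m} f y t := by
        refine (Quotient.sound (hs' ?_ t)).trans
          (congrArg (Quotient.mk s) (characteristicMap_map f _ t))
        rw [(hφ (op n) _).choose_spec]
        exact ((ConcreteCategory.congr_hom (φ.naturality f.op) _).trans
          (congrArg (Y.map f.op) (hφ (op m) y).choose_spec)).symm }
  c.homeomorph
    ⟨Quotient.lift _ hs, (SSet.toTop.map φ).hom.continuous.quotient_lift _⟩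
    (fun {n} y t => (toTop_map_characteristicMap φ _ t).trans
      (by rw [(hφ (op n) y).choose_spec]))
    fun z => by
      obtain ⟨p, rfl⟩ := Quotient.exists_rep z
      obtain ⟨n, x, t, rfl⟩ := exists_characteristicMap_eq p
      exact ⟨n, φ.app _ x, t, Quotient.sound (hs' (hφ _ _).choose_spec t)⟩

end Realization

section Chains

variable {C : Type u} [Category.{v} C] {J K : Type*} [LinearOrder J] [Fintype J] [Nonempty J]
  [LinearOrder K] [Fintype K] [Nonempty K]

/-- The enumeration of a nonempty finite linear order, with its number of elements written as a
successor so that it can serve as the vertex set of a simplex. -/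
noncomputable def vertexEquiv (J : Type*) [LinearOrder J] [Fintype J] [Nonempty J] :
    Fin (Fintype.card J - 1 + 1) ≃o J :=
  Fintype.orderIsoFinOfCardEq J (Nat.sub_add_cancel Fintype.card_pos).symm

/-- The map to the classifying space that belongs to a chain of morphisms indexed by an arbitrary
finite linear order. -/
noncomputable def chainMap (y : J ⥤ C) : C(stdSimplex ℝ J, ClassifyingSpace C) :=
  (characteristicMap (X := nerve C) (n := .mk (Fintype.card J - 1))
    ((vertexEquiv J).monotone.functor ⋙ y)).comp
      ⟨stdSimplex.map (vertexEquiv J).symm, stdSimplex.continuous_map _⟩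

theorem characteristicMap_functor_comp {n : SimplexCategory} (f : Fin (n.len + 1) →o J)
    (y : J ⥤ C) (t : stdSimplex ℝ (Fin (n.len + 1))) :
    characteristicMap (X := nerve C) (n := n) (f.monotone.functor ⋙ y) t =
      chainMap y (stdSimplex.map f t) := by
  obtain ⟨g, hg⟩ : ∃ g : n ⟶ .mk (Fintype.card J - 1),
      ∀ i, (vertexEquiv J).symm (f i) = g.toOrderHom i :=
    ⟨SimplexCategory.mkHom ((vertexEquiv J).symm.toOrderEmbedding.toOrderHom.comp f),
      fun _ => rfl⟩
  have h : f.monotone.functor =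
      g.toOrderHom.monotone.functor ⋙ (vertexEquiv J).monotone.functor :=
    CategoryTheory.Functor.ext (fun i => (vertexEquiv J).symm_apply_eq.1 (hg i))
      fun _ _ _ => Subsingleton.elim _ _
  rw [h]
  refine (characteristicMap_map (X := nerve C) g ((vertexEquiv J).monotone.functor ⋙ y) t).trans ?_
  refine congrArg (characteristicMap _) (Eq.trans ?_ (stdSimplex.map_comp_apply _ _ t).symm)
  exact congrArg (stdSimplex.map · t) (funext fun i => (hg i).symm)

theorem chainMap_functor_comp (f : J →o K) (y : K ⥤ C) (t : stdSimplex ℝ J) :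
    chainMap (f.monotone.functor ⋙ y) t = chainMap y (stdSimplex.map f t) := by
  refine (characteristicMap_functor_comp (n := .mk (Fintype.card J - 1))
    (f.comp (vertexEquiv J).toOrderEmbedding.toOrderHom) y _).trans (congrArg (chainMap y) ?_)
  refine (stdSimplex.map_comp_apply (vertexEquiv J).symm _ t).trans ?_
  exact congrArg (stdSimplex.map · t) (funext fun j => by simp)

end Chains

section Transition

variable {C : Type u} [Category.{v} C] [IsGroupoid C] {J K : Type*} [Preorder J] [OrderBot J]
  [Preorder K] [OrderBot K]

/-- The morphism between two objects of a chain of isomorphisms, in either direction. -/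
noncomputable def transition (x : J ⥤ C) (i j : J) : x.obj i ⟶ x.obj j :=
  inv (x.map (homOfLE (bot_le : ⊥ ≤ i))) ≫ x.map (homOfLE bot_le)

theorem transition_self (x : J ⥤ C) (i : J) : transition x i i = 𝟙 _ :=
  IsIso.inv_hom_id _

theorem transition_comp (x : J ⥤ C) (i j k : J) :
    transition x i j ≫ transition x j k = transition x i k := by
  simp [transition]

theorem transition_of_le (x : J ⥤ C) {i j : J} (h : i ⟶ j) : transition x i j = x.map h := by
  rw [transition, IsIso.inv_comp_eq, ← x.map_comp]
  rfl

theorem transition_functor_comp (f : J →o K) (x : K ⥤ C) (i j : J) :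
    transition (f.monotone.functor ⋙ x) i j = transition x (f i) (f j) := by
  refine (IsIso.inv_comp_eq _).2 ?_
  refine (transition_of_le x (f.monotone.functor.map (homOfLE bot_le))).symm.trans ?_
  refine (transition_comp x _ _ _).symm.trans (congrArg (· ≫ transition x (f i) (f j)) ?_)
  exact transition_of_le x (f.monotone.functor.map (homOfLE bot_le))

end Transition

section SegmentPoint

variable {ι κ : Type*} [Fintype ι] [Fintype κ]

/-- The point dividing the segment between two points of a simplex in the ratio `s : 1 - s`. -/
noncomputable def segmentPoint (p q : stdSimplex ℝ ι) (s : unitInterval) : stdSimplex ℝ ι :=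
  ⟨(1 - (s : ℝ)) • (p : ι → ℝ) + (s : ℝ) • (q : ι → ℝ),
    convex_stdSimplex ℝ ι p.2 q.2 (sub_nonneg.2 s.2.2) s.2.1 (by ring)⟩

theorem map_segmentPoint (f : ι → κ) (p q : stdSimplex ℝ ι) (s : unitInterval) :
    stdSimplex.map f (segmentPoint p q s) =
      segmentPoint (stdSimplex.map f p) (stdSimplex.map f q) s :=
  Subtype.ext ((map_add _ _ _).trans (congrArg₂ _ (map_smul _ _ _) (map_smul _ _ _)))

theorem segmentPoint_zero (p q : stdSimplex ℝ ι) : segmentPoint p q 0 = p :=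
  Subtype.ext <| by
    simp only [segmentPoint, Set.Icc.coe_zero, sub_zero, one_smul, zero_smul, add_zero]
    rfl

theorem segmentPoint_one (p q : stdSimplex ℝ ι) : segmentPoint p q 1 = q :=
  Subtype.ext <| by
    simp only [segmentPoint, Set.Icc.coe_one, sub_self, one_smul, zero_smul, zero_add]
    rfl

theorem continuous_segmentPoint :
    Continuous fun a : (stdSimplex ℝ ι × stdSimplex ℝ ι) × unitInterval =>
      segmentPoint a.1.1 a.1.2 a.2 := by
  have hp : Continuous fun a : (stdSimplex ℝ ι × stdSimplex ℝ ι) × unitInterval =>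
      (a.1.1 : ι → ℝ) := continuous_subtype_val.comp (continuous_fst.comp continuous_fst)
  have hq : Continuous fun a : (stdSimplex ℝ ι × stdSimplex ℝ ι) × unitInterval =>
      (a.1.2 : ι → ℝ) := continuous_subtype_val.comp (continuous_snd.comp continuous_fst)
  have hs : Continuous fun a : (stdSimplex ℝ ι × stdSimplex ℝ ι) × unitInterval => (a.2 : ℝ) :=
    continuous_subtype_val.comp continuous_snd
  exact (((continuous_const.sub hs).smul hp).add (hs.smul hq)).subtype_mk _

end SegmentPoint

section Doubling

variable {C : Type u} [Category.{v} C] {J K : Type*} [Preorder J] [Preorder K]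

/-- The inclusion of a layer into the ordered sum of two copies of `J`. -/
def layer (J : Type*) [Preorder J] (b : Fin 2) : J →o Fin 2 ×ₗ J :=
  ⟨fun j => toLex (b, j), fun _ _ h => Prod.Lex.toLex_mono ⟨le_rfl, h⟩⟩

/-- The map of ordered sums of two copies that is induced by a monotone map. -/
def mapLayers (f : J →o K) : Fin 2 ×ₗ J →o Fin 2 ×ₗ K :=
  ⟨fun k => toLex ((ofLex k).1, f (ofLex k).2), fun _ _ h => Prod.Lex.toLex_le_toLex.2
    ((Prod.Lex.le_iff.1 h).imp_right fun h => ⟨h.1, f.monotone h.2⟩)⟩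

variable [IsGroupoid C] [OrderBot J] [OrderBot K]

/-- The chain `(0, x₀) → ⋯ → (0, xₙ) → (1, x₀) → ⋯ → (1, xₙ)` that belongs to a chain
`x₀ → ⋯ → xₙ` of isomorphisms. The morphism from `(0, xₙ)` to `(1, x₀)` runs backwards through the
given chain, which spares the triangulation of the prism `Δⁿ × Δ¹`. -/
noncomputable def doubling (x : J ⥤ C) : Fin 2 ×ₗ J ⥤ Fin 2 × C where
  obj k := ((ofLex k).1, x.obj (ofLex k).2)
  map {k l} h := (homOfLE (Prod.Lex.monotone_fst k l (leOfHom h)),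
    transition x (ofLex k).2 (ofLex l).2)
  map_id _ := Prod.ext rfl (transition_self x _)
  map_comp _ _ := Prod.ext rfl (transition_comp x _ _ _).symm

theorem layer_functor_comp_doubling (x : J ⥤ C) (b : Fin 2) :
    (layer J b).monotone.functor ⋙ doubling x = x ⋙ Prod.sectR b C :=
  Functor.hext (fun _ => rfl) fun _ _ h => heq_of_eq (Prod.ext rfl (transition_of_le x h))

theorem mapLayers_functor_comp_doubling (f : J →o K) (x : K ⥤ C) :
    (mapLayers f).monotone.functor ⋙ doubling x = doubling (f.monotone.functor ⋙ x) :=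
  Functor.hext (fun _ => rfl) fun _ _ _ =>
    heq_of_eq (Prod.ext rfl (transition_functor_comp f x _ _).symm)

end Doubling

section Homotopy

variable {C D E : Type u} [Category.{v} C] [Category.{v} D] [Category.{v} E]

/-- The family of maps `Δⁿ × [0, 1] → B(Fin 2 × C)` that moves every simplex of `BC` along the
segments joining the two layers of its doubling. -/
noncomputable def cylinderCocone (C : Type u) [Category.{v} C] [IsGroupoid C] :
    RealizationCocone (nerve C) C(unitInterval, ClassifyingSpace (Fin 2 × C)) where
  toFun {n} x := (⟨fun a : stdSimplex ℝ (Fin (n.len + 1)) × unitInterval =>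
    chainMap (doubling x) (segmentPoint (stdSimplex.map (layer _ 0) a.1)
      (stdSimplex.map (layer _ 1) a.1) a.2), (map_continuous _).comp
        (continuous_segmentPoint.comp (.prodMk (.prodMk
          ((stdSimplex.continuous_map _).comp continuous_fst)
          ((stdSimplex.continuous_map _).comp continuous_fst)) continuous_snd))⟩ :
    C(stdSimplex ℝ (Fin (n.len + 1)) × unitInterval, _)).curry
  map {n m} f x t := by
    ext s
    have h := congrArg (fun y => chainMap y (segmentPoint (stdSimplex.map (layer _ 0) t)
      (stdSimplex.map (layer _ 1) t) s)) (mapLayers_functor_comp_doubling f.toOrderHom x)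
    refine h.symm.trans ((chainMap_functor_comp (mapLayers f.toOrderHom) (doubling x) _).trans ?_)
    refine congrArg (chainMap (doubling x)) ?_
    simp only [map_segmentPoint, stdSimplex.map_comp_apply]
    rfl

theorem chainMap_doubling_layer [IsGroupoid C] {n : SimplexCategory} (x : (nerve C).obj (op n))
    (b : Fin 2) (t : stdSimplex ℝ (Fin (n.len + 1))) :
    chainMap (doubling x) (stdSimplex.map (layer _ b) t) =
      classifyingSpaceMap (Prod.sectR b C) (characteristicMap x t) := by
  refine (characteristicMap_functor_comp (n := n) (layer _ b) (doubling x) t).symm.trans ?_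
  refine (congrArg (fun y => characteristicMap (X := nerve (Fin 2 × C)) (n := n) y t)
    (layer_functor_comp_doubling x b)).trans ?_
  exact (toTop_map_characteristicMap (nerveMap (Prod.sectR b C)) x t).symm

theorem classifyingSpaceMap_sectR_homotopic (C : Type u) [Category.{v} C] [IsGroupoid C] :
    (classifyingSpaceMap (Prod.sectR (0 : Fin 2) C)).hom.Homotopic
      (classifyingSpaceMap (Prod.sectR (1 : Fin 2) C)).hom := by
  let H := (cylinderCocone C).desc
  refine ⟨⟨⟨fun a => H a.2 a.1,
    (ContinuousMap.continuous_uncurry_of_continuous H).comp continuous_swap⟩,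
    fun p => ?_, fun p => ?_⟩⟩
  all_goals
    obtain ⟨n, x, t, rfl⟩ := exists_characteristicMap_eq p
  · refine (congrArg (· 0) ((cylinderCocone C).desc_characteristicMap x t)).trans ?_
    exact (congrArg _ (segmentPoint_zero _ _)).trans (chainMap_doubling_layer x 0 t)
  · refine (congrArg (· 1) ((cylinderCocone C).desc_characteristicMap x t)).trans ?_
    exact (congrArg _ (segmentPoint_one _ _)).trans (chainMap_doubling_layer x 1 t)

theorem classifyingSpaceMap_id : (classifyingSpaceMap (𝟭 C)).hom = ContinuousMap.id _ :=
  congrArg TopCat.Hom.hom (SSet.toTop.map_id (nerve C))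

theorem classifyingSpaceMap_comp (F : C ⥤ D) (G : D ⥤ E) :
    (classifyingSpaceMap (F ⋙ G)).hom =
      (classifyingSpaceMap G).hom.comp (classifyingSpaceMap F).hom :=
  congrArg TopCat.Hom.hom (SSet.toTop.map_comp (nerveMap F) (nerveMap G))

theorem exists_classifyingSpaceMap_const_eq (d : D) :
    ∃ p, (classifyingSpaceMap ((Functor.const C).obj d)).hom = ContinuousMap.const _ p := by
  let v : (nerve D).obj (op (.mk 0)) := ComposableArrows.mk₀ d
  refine ⟨characteristicMap v default, realization_ext fun {n} x t => ?_⟩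
  refine (toTop_map_characteristicMap (nerveMap ((Functor.const C).obj d)) x t).trans ?_
  refine (characteristicMap_map (SimplexCategory.const n (.mk 0) 0) v t).trans ?_
  exact congrArg (characteristicMap v) (Subsingleton.elim _ _)

theorem classifyingSpaceMap_homotopic [IsGroupoid C] {F G : C ⥤ D} (α : F ⟶ G) :
    (classifyingSpaceMap F).hom.Homotopic (classifyingSpaceMap G).hom := by
  let A : Fin 2 × C ⥤ D := Functor.uncurry.obj (ComposableArrows.mk₁ α)
  have hF : Prod.sectR 0 C ⋙ A = F := Functor.hext (fun _ => rfl) fun _ _ _ =>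
    heq_of_eq (Category.id_comp _)
  have hG : Prod.sectR 1 C ⋙ A = G := Functor.hext (fun _ => rfl) fun _ _ _ =>
    heq_of_eq (Category.id_comp _)
  rw [← hF, ← hG, classifyingSpaceMap_comp, classifyingSpaceMap_comp]
  exact .comp (.refl _) (classifyingSpaceMap_sectR_homotopic C)

/-- The homotopy equivalence of classifying spaces that is induced by an equivalence of
groupoids. -/
noncomputable def classifyingSpaceHomotopyEquiv [IsGroupoid C] [IsGroupoid D] (e : C ≌ D) :
    ContinuousMap.HomotopyEquiv (ClassifyingSpace C) (ClassifyingSpace D) where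
  toFun := (classifyingSpaceMap e.functor).hom
  invFun := (classifyingSpaceMap e.inverse).hom
  left_inv := by
    rw [← classifyingSpaceMap_comp, ← classifyingSpaceMap_id]
    exact classifyingSpaceMap_homotopic e.unitIso.inv
  right_inv := by
    rw [← classifyingSpaceMap_comp, ← classifyingSpaceMap_id]
    exact classifyingSpaceMap_homotopic e.counitIso.hom

end Homotopy

namespace AdjointGroupoid

variable {G : Type u} [Group G]

theorem inClass_of_hom {c : ConjClasses G} {a b : AdjointGroupoid G} (f : a ⟶ b)
    (h : inClass c a) : inClass c b :=
  (ConjClasses.mk_eq_mk_iff_isConj.2 (isConj_iff.2 ⟨f.1, f.2⟩)).symm.trans h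

theorem inClass_obj {n : ℕ} (x : ComposableArrows (AdjointGroupoid G) n) (i : Fin (n + 1)) :
    inClass (ConjClasses.mk (x.obj 0).elt) (x.obj i) :=
  inClass_of_hom (x.map (homOfLE (Fin.zero_le i))) rfl

theorem bijective_sigma_comp_ι (n : ℕ) :
    Function.Bijective fun p : Σ c : ConjClasses G, ComposableArrows (Component c) n =>
      (p.2 ⋙ (inClass p.1).ι : ComposableArrows (AdjointGroupoid G) n) := by
  refine Function.bijective_iff_has_inverse.2
    ⟨fun x => ⟨_, (inClass _).lift x (inClass_obj x)⟩, fun ⟨c, x⟩ => ?_, fun _ => rfl⟩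
  have lift_eq {d : ConjClasses G} (h : d = c) (hd : ∀ i, inClass d (x.obj i).obj) :
      (⟨d, (inClass d).lift (x ⋙ (inClass c).ι) hd⟩ :
        Σ c : ConjClasses G, ComposableArrows (Component c) n) = ⟨c, x⟩ := by
    subst h
    rfl
  exact lift_eq (x.obj 0).property _

theorem isHomeomorph_fromCoproduct (G : Type u) [Group G] : IsHomeomorph (fromCoproduct G) :=
  isHomeomorph_sigma_toTop_map (fun c : ConjClasses G => nerveMap (inClass c).ι)
    fun n => bijective_sigma_comp_ι n.unop.len

namespace Component

variable {c : ConjClasses G}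

/-- The group element that underlies a morphism of the subgroupoid of a conjugacy class. -/
def val {a b : Component c} (f : a ⟶ b) : G := f.hom.1

theorem conj_val {a b : Component c} (f : a ⟶ b) :
    val f * a.obj.elt * (val f)⁻¹ = b.obj.elt := f.hom.2

theorem val_comp {a b d : Component c} (f : a ⟶ b) (f' : b ⟶ d) :
    val (f ≫ f') = val f' * val f := rfl

theorem val_injective {a b : Component c} : Function.Injective (val : (a ⟶ b) → G) :=
  fun _ _ h => ObjectProperty.hom_ext _ (Subtype.ext h)

theorem val_eqToHom {a b : Component c} (h : a = b) : val (eqToHom h) = 1 := by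
  subst h
  rfl

theorem functor_ext_iff {J : Type v} [Category.{w} J] {x y : J ⥤ Component c} :
    x = y ↔ (∀ j, (x.obj j).obj.elt = (y.obj j).obj.elt) ∧
      ∀ {i j : J} (f : i ⟶ j), val (x.map f) = val (y.map f) := by
  refine ⟨?_, fun ⟨hobj, hmap⟩ => CategoryTheory.Functor.ext
    (fun j => ObjectProperty.FullSubcategory.ext (AdjointGroupoid.ext (hobj j)))
    fun i j f => val_injective ?_⟩
  · rintro rfl
    exact ⟨fun _ => rfl, fun _ => rfl⟩
  · rw [val_comp, val_comp, val_eqToHom, val_eqToHom, one_mul, mul_one, hmap]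

end Component

end AdjointGroupoid

namespace RightGroupoid

open AdjointGroupoid

variable {G : Type u} [Group G]

/-- The functor from the right action groupoid to the subgroupoid of the conjugacy class of `g`
that sends `a` to `a⁻¹ * g * a`. -/
def toComponent (g : G) : RightGroupoid G ⥤ Component (ConjClasses.mk g) where
  obj a := ⟨⟨a.elt⁻¹ * g * a.elt⟩, ConjClasses.mk_eq_mk_iff_isConj.2
    (isConj_iff.2 ⟨a.elt, by group⟩)⟩
  map {a b} x := ObjectProperty.homMk ⟨x.1⁻¹, by
    calc
      x.1⁻¹ * (a.elt⁻¹ * g * a.elt) * x.1⁻¹⁻¹ = (a.elt * x.1)⁻¹ * g * (a.elt * x.1) := by group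
      _ = b.elt⁻¹ * g * b.elt := congrArg (fun c => c⁻¹ * g * c) x.2⟩
  map_id _ := Component.val_injective (inv_one : (1 : G)⁻¹ = 1)
  map_comp x y := Component.val_injective (mul_inv_rev x.1 y.1)

variable {g : G} {n : ℕ}

theorem toComponent_comp_surjective :
    Function.Surjective fun x : ComposableArrows (RightGroupoid G) n =>
      (x ⋙ toComponent g : ComposableArrows _ n) := by
  intro y
  obtain ⟨a, ha⟩ := isConj_iff.1 (ConjClasses.mk_eq_mk_iff_isConj.1 (y.obj 0).property).symm
  let o (i : Fin (n + 1)) : y.obj 0 ⟶ y.obj i := y.map (homOfLE (Fin.zero_le i))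
  have ho {i j : Fin (n + 1)} (f : i ⟶ j) :
      Component.val (o j) = Component.val (y.map f) * Component.val (o i) := by
    rw [← Component.val_comp, ← y.map_comp]
    rfl
  let x : ComposableArrows (RightGroupoid G) n :=
    { obj i := ⟨a⁻¹ * (Component.val (o i))⁻¹⟩
      map f := ⟨(Component.val (y.map f))⁻¹, by simp only [ho f, mul_inv_rev, mul_assoc]⟩
      map_id _ := Subsingleton.elim _ _
      map_comp _ _ := Subsingleton.elim _ _ }
  refine ⟨x, Component.functor_ext_iff.2 ⟨fun i => ?_, fun f => inv_inv _⟩⟩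
  calc
    (a⁻¹ * (Component.val (o i))⁻¹)⁻¹ * g * (a⁻¹ * (Component.val (o i))⁻¹) =
        Component.val (o i) * (a * g * a⁻¹) * (Component.val (o i))⁻¹ := by group
    _ = (y.obj i).obj.elt := by rw [ha, Component.conj_val]

theorem exists_comp_leftTranslation_eq {x y : ComposableArrows (RightGroupoid G) n}
    (h : x ⋙ toComponent g = y ⋙ toComponent g) :
    ∃ k ∈ Subgroup.centralizer {g}, x ⋙ leftTranslation k = y := by
  obtain ⟨hobj, hmap⟩ := Component.functor_ext_iff.1 h
  have h₀ : (x.obj 0).elt⁻¹ * g * (x.obj 0).elt = (y.obj 0).elt⁻¹ * g * (y.obj 0).elt := hobj 0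
  refine ⟨(y.obj 0).elt * (x.obj 0).elt⁻¹, ?_, ?_⟩
  · rw [Subgroup.mem_centralizer_singleton_iff]
    have := congrArg (fun z => (y.obj 0).elt * z * (x.obj 0).elt⁻¹) h₀
    simpa [mul_assoc] using this
  · refine nerve.ext_of_isThin (C := RightGroupoid G) (n := op (.mk n))
      (funext fun i => RightGroupoid.ext ?_)
    let f : (0 : Fin (n + 1)) ⟶ i := homOfLE (Fin.zero_le i)
    have hf : (x.map f).1 = (y.map f).1 := inv_injective (hmap f)
    change (y.obj 0).elt * (x.obj 0).elt⁻¹ * (x.obj i).elt = (y.obj i).elt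
    rw [← (x.map f).2, ← (y.map f).2, hf, mul_assoc, inv_mul_cancel_left]

theorem leftTranslation_comp_toComponent {k : G} (hk : k ∈ Subgroup.centralizer {g}) :
    leftTranslation k ⋙ toComponent g = toComponent g := by
  refine Component.functor_ext_iff.2 ⟨fun a => ?_, fun _ => rfl⟩
  change (k * a.elt)⁻¹ * g * (k * a.elt) = a.elt⁻¹ * g * a.elt
  have hk' : k⁻¹ * (g * k) = g := by
    rw [← Subgroup.mem_centralizer_singleton_iff.1 hk, inv_mul_cancel_left]
  rw [mul_inv_rev, ← mul_assoc, mul_assoc a.elt⁻¹, mul_assoc a.elt⁻¹, mul_assoc k⁻¹, hk']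

/-- The classifying space of the subgroupoid of the conjugacy class of `g` as the orbit space of
the action of the centralizer of `g` on the classifying space of the right action groupoid. -/
noncomputable def orbitSpaceHomeomorph (g : G) :
    MulAction.orbitRel.Quotient (Subgroup.centralizer {g})
      (ClassifyingSpace (RightGroupoid G)) ≃ₜ
        ClassifyingSpace (Component (ConjClasses.mk g)) :=
  quotientRealizationHomeomorph (nerveMap (toComponent g)) _
    (fun n => toComponent_comp_surjective (n := n.unop.len))
    (by
      rintro _ q ⟨⟨k, hk⟩, rfl⟩
      change (classifyingSpaceMap (toComponent g)).hom
        ((classifyingSpaceMap (leftTranslation k)).hom q) = _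
      rw [← ContinuousMap.comp_apply, ← classifyingSpaceMap_comp,
        leftTranslation_comp_toComponent hk]
      rfl)
    fun {n x y} h t => by
      obtain ⟨k, hk, rfl⟩ := exists_comp_leftTranslation_eq h
      exact (MulAction.orbitRel (Subgroup.centralizer {g})
        (ClassifyingSpace (RightGroupoid G))).symm
        ⟨⟨k, hk⟩, toTop_map_characteristicMap (nerveMap (leftTranslation k)) x t⟩

end RightGroupoid

section StepFunctions

open MeasureTheory

/-- Functions on a measure space with the pseudometric that measures the set where two functions
differ, a continuous analogue of the Hamming distance. -/
def HammingFunction (α : Type v) (β : Type w) : Type max v w := α → β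

namespace HammingFunction

variable {α : Type v} {β : Type w} [MeasureSpace α]

noncomputable instance : PseudoEMetricSpace (HammingFunction α β) where
  edist f g := volume {s | f s ≠ g s}
  edist_self f := by simp
  edist_comm f g := by simp only [ne_comm]
  edist_triangle f g h := by
    refine (measure_mono fun s hs => ?_).trans (measure_union_le _ _)
    by_contra! hc
    simp only [Set.mem_union, Set.mem_ofPred_eq, not_or, not_not] at hc
    exact hs (hc.1.trans hc.2)

theorem edist_def (f g : HammingFunction α β) : edist f g = volume {s | f s ≠ g s} := rfl

theorem edist_eq_one [IsProbabilityMeasure (volume : Measure α)] {f g : HammingFunction α β}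
    (h : ∀ s, f s ≠ g s) : edist f g = 1 := by
  have huniv : {s | f s ≠ g s} = Set.univ := Set.eq_univ_of_forall h
  rw [edist_def, huniv, measure_univ]

end HammingFunction

noncomputable instance : MeasureSpace (Set.Ico (0 : ℝ) 1) := Measure.Subtype.measureSpace

instance : IsProbabilityMeasure (volume : Measure (Set.Ico (0 : ℝ) 1)) where
  measure_univ := by
    rw [Measure.Subtype.volume_univ nullMeasurableSet_Ico, Real.volume_Ico, sub_zero,
      ENNReal.ofReal_one]

section Subdivision

variable {n m : ℕ}

/-- The sum of the first barycentric coordinates of a point of a simplex. The partial sums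
subdivide the unit interval into intervals whose lengths are the barycentric coordinates. -/
noncomputable def partialSum (t : stdSimplex ℝ (Fin (n + 1))) (i : Fin (n + 1)) : ℝ :=
  ∑ j ∈ Finset.Iic i, t j

theorem partialSum_mono (t : stdSimplex ℝ (Fin (n + 1))) : Monotone (partialSum t) :=
  fun _ _ h => Finset.sum_le_sum_of_subset_of_nonneg (Finset.Iic_subset_Iic.2 h)
    fun _ _ _ => stdSimplex.zero_le t _

theorem partialSum_last (t : stdSimplex ℝ (Fin (n + 1))) : partialSum t (Fin.last n) = 1 := by
  rw [partialSum, ← Fin.top_eq_last, Finset.Iic_top, stdSimplex.sum_eq_one]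

theorem continuous_partialSum (i : Fin (n + 1)) :
    Continuous fun t : stdSimplex ℝ (Fin (n + 1)) => partialSum t i :=
  continuous_finsetSum _ fun j _ => (continuous_apply j).comp continuous_subtype_val

theorem partialSum_map (f : Fin (n + 1) → Fin (m + 1)) (t : stdSimplex ℝ (Fin (n + 1)))
    (j : Fin (m + 1)) : partialSum (stdSimplex.map f t) j = ∑ i with f i ≤ j, t i := by
  classical
  simp only [partialSum, stdSimplex.map_coe, FunOnFinite.linearMap_apply_apply]
  rw [Finset.sum_fiberwise_eq_sum_filter]
  simp only [Finset.mem_Iic]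

theorem exists_le_iff_lt_partialSum (t : stdSimplex ℝ (Fin (n + 1))) (s : Set.Ico (0 : ℝ) 1) :
    ∃ i, ∀ j, i ≤ j ↔ s.1 < partialSum t j := by
  have hlast : s.1 < partialSum t (Fin.last n) := s.2.2.trans_eq (partialSum_last t).symm
  obtain ⟨i, hi, hmin⟩ := exists_minimal_of_wellFoundedLT (fun j => s.1 < partialSum t j)
    ⟨_, hlast⟩
  exact ⟨i, fun j => ⟨fun h => hi.trans_le (partialSum_mono t h),
    fun h => (le_total i j).elim id (hmin h)⟩⟩

/-- The index of the subinterval that contains `s`, when the unit interval is subdivided into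
intervals whose lengths are the barycentric coordinates of `t`. -/
noncomputable def subintervalIndex (t : stdSimplex ℝ (Fin (n + 1))) (s : Set.Ico (0 : ℝ) 1) :
    Fin (n + 1) :=
  (exists_le_iff_lt_partialSum t s).choose

theorem subintervalIndex_le_iff {t : stdSimplex ℝ (Fin (n + 1))} {s : Set.Ico (0 : ℝ) 1}
    {j : Fin (n + 1)} : subintervalIndex t s ≤ j ↔ s.1 < partialSum t j :=
  (exists_le_iff_lt_partialSum t s).choose_spec j

theorem subintervalIndex_map {f : Fin (n + 1) → Fin (m + 1)} (hf : Monotone f)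
    (t : stdSimplex ℝ (Fin (n + 1))) (s : Set.Ico (0 : ℝ) 1) :
    subintervalIndex (stdSimplex.map f t) s = f (subintervalIndex t s) := by
  refine eq_of_forall_ge_iff fun j => ?_
  rw [subintervalIndex_le_iff, partialSum_map]
  constructor
  · intro h
    have hne : ({i | f i ≤ j} : Finset (Fin (n + 1))).Nonempty :=
      Finset.nonempty_of_sum_ne_zero (s.2.1.trans_lt h).ne'
    have hmax := (Finset.mem_filter_univ _).1 (Finset.max'_mem _ hne)
    refine (hf (subintervalIndex_le_iff.2 (h.trans_le ?_))).trans hmax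
    exact Finset.sum_le_sum_of_subset_of_nonneg
      (fun i hi => Finset.mem_Iic.2 (Finset.le_max' _ _ hi)) fun _ _ _ => stdSimplex.zero_le t _
  · intro h
    refine (subintervalIndex_le_iff.1 (le_refl (subintervalIndex t s))).trans_le ?_
    exact Finset.sum_le_sum_of_subset_of_nonneg
      (fun i hi => (Finset.mem_filter_univ _).2 ((hf (Finset.mem_Iic.1 hi)).trans h))
      fun _ _ _ => stdSimplex.zero_le t _

theorem mem_uIcc_partialSum_of_subintervalIndex_lt {t t' : stdSimplex ℝ (Fin (n + 1))}
    {s : Set.Ico (0 : ℝ) 1} (h : subintervalIndex t s < subintervalIndex t' s) :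
    s.1 ∈ Set.uIcc (partialSum t (subintervalIndex t s))
      (partialSum t' (subintervalIndex t s)) :=
  Set.mem_uIcc.2 (Or.inr ⟨not_lt.1 fun h' => h.not_ge (subintervalIndex_le_iff.2 h'),
    (subintervalIndex_le_iff.1 le_rfl).le⟩)

/-- The step function with given values on the subintervals that belong to a point of a simplex. -/
noncomputable def stepFunction {β : Type v} (a : Fin (n + 1) → β)
    (t : stdSimplex ℝ (Fin (n + 1))) : HammingFunction (Set.Ico (0 : ℝ) 1) β :=
  fun s => a (subintervalIndex t s)

theorem edist_stepFunction_le {β : Type v} (a : Fin (n + 1) → β)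
    (t t' : stdSimplex ℝ (Fin (n + 1))) :
    edist (stepFunction a t) (stepFunction a t') ≤
      ∑ j, edist (partialSum t j) (partialSum t' j) := by
  have hsub : {s : Set.Ico (0 : ℝ) 1 | stepFunction a t s ≠ stepFunction a t' s} ⊆
      ⋃ j ∈ (Finset.univ : Finset (Fin (n + 1))),
        Subtype.val ⁻¹' Set.uIcc (partialSum t j) (partialSum t' j) := by
    intro s hs
    simp only [Finset.mem_univ, Set.iUnion_true, Set.mem_iUnion]
    rcases lt_or_gt_of_ne fun h => hs (congrArg a h) with h | h
    · exact ⟨_, mem_uIcc_partialSum_of_subintervalIndex_lt h⟩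
    · exact ⟨_, Set.uIcc_comm (partialSum t' _) _ ▸ mem_uIcc_partialSum_of_subintervalIndex_lt h⟩
  refine (measure_mono hsub).trans ((measure_biUnion_finset_le _ _).trans
    (Finset.sum_le_sum fun j _ => ?_))
  calc
    volume (Subtype.val ⁻¹' Set.uIcc (partialSum t j) (partialSum t' j) : Set (Set.Ico (0 : ℝ) 1))
      = volume (Set.uIcc (partialSum t j) (partialSum t' j) ∩ Set.Ico 0 1) :=
        volume_preimage_coe nullMeasurableSet_Ico measurableSet_uIcc
    _ ≤ volume (Set.uIcc (partialSum t j) (partialSum t' j)) := measure_mono Set.inter_subset_left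
    _ = edist (partialSum t j) (partialSum t' j) := by
        rw [Real.volume_interval, edist_comm, edist_dist, Real.dist_eq]

theorem continuous_stepFunction {β : Type v} (a : Fin (n + 1) → β) :
    Continuous (stepFunction a) := by
  refine continuous_iff_continuousAt.2 fun t => tendsto_iff_edist_tendsto_0.2 ?_
  refine tendsto_of_tendsto_of_tendsto_of_le_of_le tendsto_const_nhds ?_
    (fun _ => bot_le) fun t' => edist_stepFunction_le a t' t
  rw [← Finset.sum_const_zero (ι := Fin (n + 1)) (s := Finset.univ)]
  exact tendsto_finsetSum _ fun j _ =>
    tendsto_iff_edist_tendsto_0.1 (continuous_partialSum j).continuousAt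

end Subdivision

end StepFunctions

namespace RightGroupoid

variable {G : Type u} [Group G]

/-- The cocone that assigns to a point of a simplex with vertices `a 0, …, a n` the step function
with these values. -/
noncomputable def stepFunctionCocone (G : Type u) [Group G] :
    RealizationCocone (nerve (RightGroupoid G)) (HammingFunction (Set.Ico (0 : ℝ) 1) G) where
  toFun {n} x := ⟨stepFunction fun i : Fin (n.len + 1) => (x.obj i).elt,
    continuous_stepFunction _⟩
  map {_ m} f x t := funext fun s =>
    (congrArg (fun i : Fin (m.len + 1) => (x.obj i).elt)
      (subintervalIndex_map (SimplexCategory.Hom.toOrderHom f).monotone t s)).symm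

/-- The map to the step functions that detects the action of `G` on the classifying space. -/
noncomputable def toStepFunction (G : Type u) [Group G] :
    C(ClassifyingSpace (RightGroupoid G), HammingFunction (Set.Ico (0 : ℝ) 1) G) :=
  (stepFunctionCocone G).desc

theorem toStepFunction_smul (h : G) (p : ClassifyingSpace (RightGroupoid G))
    (s : Set.Ico (0 : ℝ) 1) : toStepFunction G (h • p) s = h * toStepFunction G p s := by
  obtain ⟨n, x, t, rfl⟩ := exists_characteristicMap_eq p
  calc
    toStepFunction G (h • characteristicMap x t) s
      = toStepFunction G
          (characteristicMap ((nerveMap (leftTranslation h)).app (op n) x) t) s :=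
        congrArg (toStepFunction G · s)
          (toTop_map_characteristicMap (nerveMap (leftTranslation h)) x t)
    _ = h * (stepFunctionCocone G).toFun x t s :=
        congrFun ((stepFunctionCocone G).desc_characteristicMap _ t) s
    _ = h * toStepFunction G (characteristicMap x t) s :=
        congrArg (h * ·) (congrFun ((stepFunctionCocone G).desc_characteristicMap x t) s).symm

-- A nontrivial translation changes a step function everywhere, hence moves it by distance one.
theorem exists_nhds_forall_image_smul_inter_nonempty (p : ClassifyingSpace (RightGroupoid G)) :
    ∃ U ∈ nhds p, ∀ h : G, ((h • ·) '' U ∩ U).Nonempty → h = 1 := by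
  refine ⟨toStepFunction G ⁻¹' Metric.eball (toStepFunction G p) 2⁻¹,
    (toStepFunction G).continuous.continuousAt (Metric.eball_mem_nhds _ (by simp)), ?_⟩
  rintro h ⟨_, ⟨q, hq, rfl⟩, hq'⟩
  by_contra hh
  have hfar : edist (toStepFunction G (h • q)) (toStepFunction G q) = 1 :=
    HammingFunction.edist_eq_one fun s => by
      rw [toStepFunction_smul]
      exact fun h_eq => hh (mul_eq_right.1 h_eq)
  have hnear : edist (toStepFunction G (h • q)) (toStepFunction G q) < 2⁻¹ + 2⁻¹ :=
    (edist_triangle_right _ _ (toStepFunction G p)).trans_lt (ENNReal.add_lt_add hq' hq)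
  rw [hfar, ENNReal.inv_two_add_inv_two] at hnear
  exact lt_irrefl _ hnear

instance : ContinuousConstSMul G (ClassifyingSpace (RightGroupoid G)) where
  continuous_const_smul h := (classifyingSpaceMap (leftTranslation h)).hom.continuous

theorem isQuotientCoveringMap_orbitRel_mk (H : Subgroup G) :
    IsQuotientCoveringMap
      (Quotient.mk (MulAction.orbitRel H (ClassifyingSpace (RightGroupoid G)))) H where
  toIsQuotientMap := isQuotientMap_quotient_mk'
  continuous_const_smul h := continuous_const_smul (h : G)
  apply_eq_iff_mem_orbit := Quotient.eq
  disjoint p := by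
    obtain ⟨U, hU, h⟩ := exists_nhds_forall_image_smul_inter_nonempty p
    exact ⟨U, hU, fun k hk => Subtype.ext (h k hk)⟩

instance : ContractibleSpace (ClassifyingSpace (RightGroupoid G)) := by
  let α : 𝟭 (RightGroupoid G) ⟶ (Functor.const _).obj ⟨1⟩ :=
    { app a := ⟨a.elt⁻¹, mul_inv_cancel a.elt⟩
      naturality _ _ _ := Subsingleton.elim _ _ }
  obtain ⟨p, hp⟩ := exists_classifyingSpaceMap_const_eq (C := RightGroupoid G)
    (D := RightGroupoid G) ⟨1⟩
  rw [contractible_iff_id_nullhomotopic]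
  refine ⟨p, ?_⟩
  rw [← hp, ← classifyingSpaceMap_id]
  exact classifyingSpaceMap_homotopic α

end RightGroupoid

open scoped unitInterval Topology.Homotopy

section HigherHomotopy

variable {N : Type*} {E X : Type*} [TopologicalSpace E] [TopologicalSpace X] {x : X}

/-- The dilation of the unit interval about its midpoint by the factor `1 + s`, clamped to the
interval. -/
noncomputable def dilate (s r : I) : I :=
  Set.projIcc 0 1 zero_le_one ((r : ℝ) + s * ((r : ℝ) - 1 / 2))

/-- The function on the unit interval that vanishes at the end points and is `1` on the middle
half. -/
noncomputable def bump (r : I) : I := Set.projIcc 0 1 zero_le_one (4 * min (r : ℝ) (1 - r))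

theorem continuous_dilate : Continuous fun a : I × I => dilate a.1 a.2 :=
  continuous_projIcc.comp (by fun_prop)

theorem continuous_bump : Continuous bump :=
  continuous_projIcc.comp (by fun_prop)

theorem dilate_zero_left (r : I) : dilate 0 r = r := by
  rw [dilate, Set.Icc.coe_zero, zero_mul, add_zero, Set.projIcc_val]

theorem dilate_zero_right (s : I) : dilate s 0 = 0 :=
  Set.projIcc_of_le_left _ (by rw [Set.Icc.coe_zero]; linarith [s.2.1])

theorem dilate_one_right (s : I) : dilate s 1 = 1 :=
  Set.projIcc_of_right_le _ (by rw [Set.Icc.coe_one]; linarith [s.2.1])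

theorem bump_zero : bump 0 = 0 := Set.projIcc_of_le_left _ (by norm_num)

theorem bump_one : bump 1 = 0 := Set.projIcc_of_le_left _ (by norm_num)

theorem dilate_one_left_of_bump_ne_one {r : I} (h : bump r ≠ 1) :
    dilate 1 r = 0 ∨ dilate 1 r = 1 := by
  rcases le_total (r : ℝ) (1 / 4) with h₀ | h₀
  · exact Or.inl (Set.projIcc_of_le_left _ (by rw [Set.Icc.coe_one]; linarith))
  rcases le_total (3 / 4) (r : ℝ) with h₁ | h₁
  · exact Or.inr (Set.projIcc_of_right_le _ (by rw [Set.Icc.coe_one]; linarith))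
  · have hmin : 1 / 4 ≤ min (r : ℝ) (1 - r) := le_min h₀ (by linarith)
    exact absurd (Set.projIcc_of_right_le _ (by linarith)) h

theorem dilate_mem_boundary (s : I) {y : N → I} (hy : y ∈ Cube.boundary N) :
    (fun i => dilate s (y i)) ∈ Cube.boundary N :=
  hy.imp fun _ => Or.imp (fun h => (congrArg (dilate s) h).trans (dilate_zero_right s))
    fun h => (congrArg (dilate s) h).trans (dilate_one_right s)

/-- The function on the cube that vanishes on the boundary and is `1` on the middle subcube with
side `1 / 2`. -/
noncomputable def cubeBump (N : Type*) [Fintype N] : C(N → I, I) where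
  toFun y := ∏ i, bump (y i)
  continuous_toFun :=
    continuous_finsetProd _ fun i _ => continuous_bump.comp (continuous_apply i)

theorem cubeBump_eq_zero [Fintype N] {y : N → I} (hy : y ∈ Cube.boundary N) :
    cubeBump N y = 0 := by
  obtain ⟨i, hi | hi⟩ := hy
  · exact Finset.prod_eq_zero (Finset.mem_univ i) (by rw [hi, bump_zero])
  · exact Finset.prod_eq_zero (Finset.mem_univ i) (by rw [hi, bump_one])

theorem cubeBump_eq_one_or_dilate_mem_boundary [Fintype N] (y : N → I) :
    cubeBump N y = 1 ∨ (fun i => dilate 1 (y i)) ∈ Cube.boundary N := by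
  by_cases h : ∀ i, bump (y i) = 1
  · exact Or.inl (Finset.prod_eq_one fun i _ => h i)
  · obtain ⟨i, hi⟩ := not_forall.1 h
    exact Or.inr ⟨i, dilate_one_left_of_bump_ne_one hi⟩

/- The contraction moves the base point. So the loop is first squeezed into the middle subcube,
where the contraction acts to its end; outside, only the track of the base point remains. -/
theorem exists_forall_genLoop_homotopic [Finite N] [ContractibleSpace X] (x : X) :
    ∃ g : Ω^ N X x, ∀ f : Ω^ N X x, GenLoop.Homotopic f g := by
  cases nonempty_fintype N
  obtain ⟨x₀, ⟨H⟩⟩ := id_nullhomotopic X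
  let g : Ω^ N X x := ⟨⟨fun y => H (cubeBump N y, x), by fun_prop⟩,
    fun y hy => by simp [cubeBump_eq_zero hy]⟩
  refine ⟨g, fun f => ⟨{
    toFun a := H (a.1 * cubeBump N a.2, f fun i => dilate a.1 (a.2 i))
    continuous_toFun := ?_
    map_zero_left y := ?_
    map_one_left y := ?_
    prop' s y hy := ?_ }⟩⟩
  · have hdilate : Continuous fun a : I × (N → I) => fun i => dilate a.1 (a.2 i) :=
      continuous_pi fun i => continuous_dilate.comp
        (continuous_fst.prodMk ((continuous_apply i).comp continuous_snd))
    have hf := (map_continuous f).comp hdilate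
    exact (map_continuous H).comp (Continuous.prodMk (by fun_prop) hf)
  · simp [dilate_zero_left]
  · rw [one_mul]
    rcases cubeBump_eq_one_or_dilate_mem_boundary y with h | h
    · simp [g, h]
    · exact congrArg (fun z => H (cubeBump N y, z)) (GenLoop.boundary f _ h)
  · simp [cubeBump_eq_zero hy, GenLoop.boundary f _ (dilate_mem_boundary s hy),
      GenLoop.boundary f _ hy]

instance [Finite N] [ContractibleSpace X] (x : X) : Subsingleton (HomotopyGroup N X x) := by
  obtain ⟨g, hg⟩ := exists_forall_genLoop_homotopic (N := N) x
  exact ⟨Quotient.ind₂ fun f f' => Quotient.sound ((hg f).trans (hg f').symm)⟩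

theorem isPreconnected_cube_boundary [Nontrivial N] :
    _root_.IsPreconnected (Cube.boundary N) := by
  classical
  -- The face through `y` meets the face opposite to a different direction through the corner `0`.
  refine isPreconnected_of_forall 0 fun y ⟨i, hi⟩ => ?_
  obtain ⟨j, hj⟩ := exists_ne i
  let face (i : N) (r : I) : Set (N → I) := Set.range fun z : N → I => Function.update z i r
  have isPreconnected_face (i : N) (r : I) : _root_.IsPreconnected (face i r) :=
    isPreconnected_range (by fun_prop)
  refine ⟨face i (y i) ∪ face j 0, ?_, Or.inr ⟨0, Function.update_eq_self j (0 : N → I)⟩,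
    Or.inl ⟨y, Function.update_eq_self i y⟩, ?_⟩
  · rintro _ (⟨z, rfl⟩ | ⟨z, rfl⟩)
    · exact ⟨i, by simpa only [Function.update_self] using hi⟩
    · exact ⟨j, Or.inl (Function.update_self j 0 z)⟩
  · let z : N → I := Function.update 0 i (y i)
    have hz : Function.update z j 0 = z :=
      Function.update_eq_self_iff.2 (Function.update_of_ne hj (y i) (0 : N → I)).symm
    exact IsPreconnected.union z ⟨0, rfl⟩ ⟨z, hz⟩ (isPreconnected_face i _)
      (isPreconnected_face j 0)

theorem exists_genLoop_lift [Nontrivial N] {p : E → X} (hp : IsCoveringMap p) {e : E}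
    (f : Ω^ N X (p e)) : ∃ (e' : E) (f' : Ω^ N E e'), ∀ y, p (f' y) = f y := by
  have hzero : (0 : N → I) ∈ Cube.boundary N := ⟨Classical.arbitrary N, Or.inl rfl⟩
  let K : C(I × (N → I), X) := ⟨fun a => f fun i => a.1 * a.2 i,
    (map_continuous f).comp (by fun_prop)⟩
  have hK (y : N → I) : K (0, y) = p e :=
    (congrArg f (funext fun i => zero_mul (y i))).trans (GenLoop.boundary f 0 hzero)
  let F : C(N → I, E) := (hp.liftHomotopy K (.const _ e) hK).comp ⟨fun y => (1, y), by fun_prop⟩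
  have hF (y : N → I) : p (F y) = f y :=
    (congrFun (hp.liftHomotopy_lifts K (.const _ e) hK) (1, y)).trans
      (congrArg f (funext fun i => one_mul (y i)))
  have hFboundary : ∀ y ∈ Cube.boundary N, F y = F 0 := fun y hy =>
    hp.constOn_of_comp isPreconnected_cube_boundary (map_continuous F).continuousOn
      (fun a ha b hb => by rw [hF, hF, GenLoop.boundary f a ha, GenLoop.boundary f b hb])
      hy hzero
  exact ⟨F 0, ⟨F, hFboundary⟩, hF⟩

theorem genLoop_homotopic_const_of_isCoveringMap [Finite N] [Nontrivial N]
    [ContractibleSpace E] {p : E → X} (hp : IsCoveringMap p) {e : E} (f : Ω^ N X (p e)) :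
    GenLoop.Homotopic f GenLoop.const := by
  obtain ⟨e', f', hf'⟩ := exists_genLoop_lift hp f
  have he' : p e' = p e := by
    have hzero : (0 : N → I) ∈ Cube.boundary N := ⟨Classical.arbitrary N, Or.inl rfl⟩
    rw [← GenLoop.boundary f' 0 hzero, hf', GenLoop.boundary f 0 hzero]
  have hf'_null : GenLoop.Homotopic f' GenLoop.const :=
    Quotient.exact (Subsingleton.elim (α := HomotopyGroup N E e') ⟦f'⟧ ⟦GenLoop.const⟧)
  have hpush := hf'_null.comp_continuousMap ⟨p, hp.continuous⟩
  rwa [show ContinuousMap.comp ⟨p, hp.continuous⟩ f'.1 = f.1 from ContinuousMap.ext hf',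
    show ContinuousMap.comp ⟨p, hp.continuous⟩ (GenLoop.const : Ω^ N E e').1 =
      (GenLoop.const : Ω^ N X (p e)).1 from ContinuousMap.ext fun _ => he'] at hpush

theorem subsingleton_homotopyGroup_of_isCoveringMap [Finite N] [Nontrivial N]
    [ContractibleSpace E] {p : E → X} (hp : IsCoveringMap p) (hsurj : Function.Surjective p)
    (x : X) : Subsingleton (HomotopyGroup N X x) := by
  obtain ⟨e, rfl⟩ := hsurj x
  exact ⟨Quotient.ind₂ fun f g => Quotient.sound
    ((genLoop_homotopic_const_of_isCoveringMap hp f).trans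
      (genLoop_homotopic_const_of_isCoveringMap hp g).symm)⟩

theorem isEilenbergMacLaneOne_of_isQuotientCoveringMap {A : Type u} [Group A] [MulAction A E]
    [ContractibleSpace E] {p : E → X} (hp : IsQuotientCoveringMap p A) :
    IsEilenbergMacLaneOne A X where
  pathConnectedSpace := hp.surjective.pathConnectedSpace hp.continuous
  fundamentalGroup x := by
    obtain ⟨e, he⟩ := hp.surjective x
    exact ⟨(hp.fundamentalGroupEquiv ⟨e, he⟩).trans (MulEquiv.inv' A).symm⟩
  higher n hn x := by
    have : Nontrivial (Fin n) := Fin.nontrivial_iff_two_le.2 hn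
    exact subsingleton_homotopyGroup_of_isCoveringMap hp.isCoveringMap hp.surjective x

end HigherHomotopy

section AsSmall

variable (C : Type) [Category.{u} C]

/-- The identification of the nerves of a category and of its universe lift. -/
def nerveAsSmallIso : nerve (AsSmall.{u} C) ≅ nerve C :=
  NatIso.ofComponents fun n => Equiv.toIso
    { toFun x := x ⋙ AsSmall.down
      invFun x := x ⋙ AsSmall.up
      left_inv _ := rfl
      right_inv _ := rfl }

/-- The identification of the classifying spaces of a category and of its universe lift. -/
noncomputable def classifyingSpaceAsSmallHomeomorph :
    ClassifyingSpace (AsSmall.{u} C) ≃ₜ ClassifyingSpace C :=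
  TopCat.homeoOfIso (SSet.toTop.mapIso (nerveAsSmallIso C))

end AsSmall

namespace AdjointGroupoid

variable {G : Type u} [Group G]

instance (c : ConjClasses G) : IsGroupoid (Component c) where
  all_isIso f :=
    have : IsIso ((inClass c).ι.map f) := IsGroupoid.all_isIso _
    isIso_of_reflects_iso f (inClass c).ι

/-- The inclusion of the centralizer of `g`, as the automorphism group of `g`, in the subgroupoid
of the conjugacy class of `g`. -/
def centralizerFunctor (g : G) :
    SingleObj (Subgroup.centralizer {g}) ⥤ Component (ConjClasses.mk g) where
  obj _ := ⟨⟨g⟩, rfl⟩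
  map k := ObjectProperty.homMk ⟨(k : Subgroup.centralizer {g}).1,
    mul_inv_eq_of_eq_mul (Subgroup.mem_centralizer_singleton_iff.1
      (k : Subgroup.centralizer {g}).2)⟩
  map_id _ := rfl
  map_comp _ _ := rfl

instance (g : G) : (centralizerFunctor g).Faithful where
  map_injective {_ _ k l} h :=
    Subtype.ext (congrArg Component.val h :
      Component.val ((centralizerFunctor g).map k) = Component.val ((centralizerFunctor g).map l))

instance (g : G) : (centralizerFunctor g).Full where
  map_surjective f := ⟨⟨Component.val f, Subgroup.mem_centralizer_singleton_iff.2
    (eq_mul_of_mul_inv_eq (Component.conj_val f))⟩, rfl⟩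

instance (g : G) : (centralizerFunctor g).EssSurj where
  mem_essImage a := by
    obtain ⟨k, hk⟩ := isConj_iff.1 (ConjClasses.mk_eq_mk_iff_isConj.1 a.property.symm)
    let f : (centralizerFunctor g).obj (SingleObj.star _) ⟶ a := ObjectProperty.homMk ⟨k, hk⟩
    exact ⟨SingleObj.star _, ⟨asIso f⟩⟩

instance (g : G) : (centralizerFunctor g).IsEquivalence where

/-- The homotopy equivalence that is induced by the equivalence of the connected groupoid
`Component (ConjClasses.mk g)` with the automorphism group of its object `g`. -/
noncomputable def componentHomotopyEquiv (g : G) : ContinuousMap.HomotopyEquiv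
    (ClassifyingSpace (Component (ConjClasses.mk g)))
    (ClassifyingSpace (SingleObj (Subgroup.centralizer {g}))) :=
  have : IsGroupoid (AsSmall.{u} (SingleObj (Subgroup.centralizer {g}))) :=
    isGroupoid_of_reflects_iso AsSmall.equiv.inverse
  -- The objects of the one-object groupoid lie in `Type`, those of the component in `Type u`.
  (classifyingSpaceHomotopyEquiv ((centralizerFunctor g).asEquivalence.symm.trans
    AsSmall.equiv)).trans
      (classifyingSpaceAsSmallHomeomorph (SingleObj (Subgroup.centralizer {g}))).toHomotopyEquiv

end AdjointGroupoid

theorem theorem7 (G : Type u) [Group G] :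
    IsHomeomorph (AdjointGroupoid.fromCoproduct G) ∧
    ∀ g : G,
      Nonempty (ClassifyingSpace (AdjointGroupoid.Component (ConjClasses.mk g)) ≃ₜ
        MulAction.orbitRel.Quotient (Subgroup.centralizer {g})
          (ClassifyingSpace (RightGroupoid G))) ∧
      IsEilenbergMacLaneOne (Subgroup.centralizer {g})
        (ClassifyingSpace (AdjointGroupoid.Component (ConjClasses.mk g))) ∧
      Nonempty (ContinuousMap.HomotopyEquiv
        (ClassifyingSpace (AdjointGroupoid.Component (ConjClasses.mk g)))
        (ClassifyingSpace (SingleObj (Subgroup.centralizer {g})))) :=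
  ⟨AdjointGroupoid.isHomeomorph_fromCoproduct G, fun g =>
    ⟨⟨(RightGroupoid.orbitSpaceHomeomorph g).symm⟩,
      isEilenbergMacLaneOne_of_isQuotientCoveringMap
        ((RightGroupoid.isQuotientCoveringMap_orbitRel_mk _).homeomorph_comp
          (RightGroupoid.orbitSpaceHomeomorph g)),
      ⟨AdjointGroupoid.componentHomotopyEquiv g⟩⟩⟩
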